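/- Let $n\in\mathbb N$, and let $\mathbb S^n_{++}$ (resp. $\mathbb S^n_{+}$) be the set of real symmetric positive definite (resp. positive semidefinite) $n\times n$ matrices. Equip the manifold $\mathbb S^n_{++}$ with the Fisher–Rao metric of the Gaussian distributions with fixed mean and covariance matrix $\Sigma$, that is, with the affine-invariant Riemannian metric $$\langle \Omega_1,\Omega_2\rangle_\Sigma=\tfrac12\operatorname{tr}\big(\Omega_1\Sigma^{-1}\Omega_2\Sigma^{-1}\big),\qquad \Sigma\in\mathbb S^n_{++},\ \Omega_1,\Omega_2 \text{ real symmetric } n\times n \text{ matrices},$$ and let $$d(\Sigma_0,\Sigma_1)=\inf_{c}\int_0^1\sqrt{\langle c'(t),c'(t)\rangle_{c(t)}}\,dt$$ be the associated Fisher–Rao distance, where the infimum is over all smooth curves $c:[0,1]\to\mathbb S^n_{++}$ with $c(0)=\Sigma_0$ and $c(1)=\Sigma_1$. For $\Sigma_0,\Sigma_1\in\mathbb S^n_{++}$, the geodesic from $\Sigma_0$ to $\Sigma_1$ is $$\gamma_{\Sigma_0,\Sigma_1}(t)=\Sigma_0^{1/2}\big(\Sigma_0^{-1/2}\Sigma_1\Sigma_0^{-1/2}\big)^{t}\,\Sigma_0^{1/2},\qquad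 t\in[0,1].$$ A set $\mathcal U\subseteq\mathbb S^n_{++}$ is called geodesically convex if $\gamma_{\Sigma_0,\Sigma_1}(t)\in\mathcal U$ for all $\Sigma_0,\Sigma_1\in\mathcal U$ and $t\in[0,1]$. A function $f:\mathbb S^n_{++}\to\mathbb R$ is called geodesically convex if $f(\gamma_{\Sigma_0,\Sigma_1}(t))\le(1-t)f(\Sigma_0)+t f(\Sigma_1)$ for all $\Sigma_0,\Sigma_1\in\mathbb S^n_{++}$ and $t\in[0,1]$. **Theorem (geodesic convexity of the optimistic likelihood problem).** For all $\widehat\Sigma\in\mathbb S^n_{++}$, $S\in\mathbb S^n_{+}$ and $\rho\ge 0$, the Fisher–Rao ball $$\mathcal B^{\mathrm{FR}}=\{\Sigma\in\mathbb S^n_{++}: d(\Sigma,\widehat\Sigma)\le\rho\}$$ is a geodesically convex set, and the function $$L(\Sigma)=\operatorname{tr}(S\,\Sigma^{-1})+\log\det\Sigma$$ is geodesically convex on $\mathbb S^n_{++}$. -/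

import Mathlib

open scoped Matrix ContDiff

namespace FisherRao

variable {n : ℕ}

/-- The real power `A ^ t` of a symmetric positive definite matrix (functional calculus of
`x ↦ x ^ t` on the eigenvalues). -/
noncomputable def matPow (A : Matrix (Fin n) (Fin n) ℝ) (t : ℝ) : Matrix (Fin n) (Fin n) ℝ :=
  cfc (fun x : ℝ => x ^ t) A

/-- The geodesic `t ↦ A^{1/2} (A^{-1/2} B A^{-1/2})^t A^{1/2}` from `A` to `B`. -/
noncomputable def geodesic (A B : Matrix (Fin n) (Fin n) ℝ) (t : ℝ) :
    Matrix (Fin n) (Fin n) ℝ :=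
  matPow A (1 / 2) * matPow (matPow A (-(1 / 2)) * B * matPow A (-(1 / 2))) t * matPow A (1 / 2)

/-- The Fisher-Rao metric `⟨X, Y⟩_A = (1/2) tr (X A⁻¹ Y A⁻¹)` on the tangent space (the symmetric
matrices) at the positive definite matrix `A`. -/
noncomputable def metric (A X Y : Matrix (Fin n) (Fin n) ℝ) : ℝ :=
  (1 / 2) * (X * A⁻¹ * Y * A⁻¹).trace

/-- `c` restricts to a smooth curve `[0,1] → {positive definite matrices}` from `A` to `B`. -/
structure IsSmoothCurve (A B : Matrix (Fin n) (Fin n) ℝ) (c : ℝ → Matrix (Fin n) (Fin n) ℝ) :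
    Prop where
  smooth : ∀ i j, ContDiffOn ℝ ∞ (fun t => c t i j) (Set.Icc 0 1)
  posDef : ∀ t ∈ Set.Icc (0 : ℝ) 1, (c t).PosDef
  source : c 0 = A
  target : c 1 = B

/-- The (entrywise) velocity of a curve parametrised by `[0,1]`. -/
noncomputable def velocity (c : ℝ → Matrix (Fin n) (Fin n) ℝ) (t : ℝ) :
    Matrix (Fin n) (Fin n) ℝ :=
  Matrix.of fun i j => derivWithin (fun s => c s i j) (Set.Icc 0 1) t

/-- The Fisher-Rao length of a curve parametrised by `[0,1]`. -/
noncomputable def length (c : ℝ → Matrix (Fin n) (Fin n) ℝ) : ℝ :=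
  ∫ t in (0 : ℝ)..1, Real.sqrt (metric (c t) (velocity c t) (velocity c t))

/-- The Fisher-Rao distance: the infimum of the lengths of the smooth curves from `A` to `B`
in the manifold of positive definite matrices. -/
noncomputable def dist (A B : Matrix (Fin n) (Fin n) ℝ) : ℝ :=
  sInf {l : ℝ | ∃ c : ℝ → Matrix (Fin n) (Fin n) ℝ, IsSmoothCurve A B c ∧ l = length c}

/-- The Fisher-Rao ball of radius `ρ` around `A`. -/
def ball (A : Matrix (Fin n) (Fin n) ℝ) (ρ : ℝ) : Set (Matrix (Fin n) (Fin n) ℝ) :=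
  {X | X.PosDef ∧ dist X A ≤ ρ}

/-- Geodesic convexity of a set of positive definite matrices. -/
def GeodesicallyConvexSet (U : Set (Matrix (Fin n) (Fin n) ℝ)) : Prop :=
  (∀ A ∈ U, A.PosDef) ∧
    ∀ A ∈ U, ∀ B ∈ U, ∀ t ∈ Set.Icc (0 : ℝ) 1, geodesic A B t ∈ U

/-- Geodesic convexity of a function on the positive definite matrices (its values at other
matrices play no role). -/
def GeodesicallyConvexFun (f : Matrix (Fin n) (Fin n) ℝ → ℝ) : Prop :=
  ∀ A B : Matrix (Fin n) (Fin n) ℝ, A.PosDef → B.PosDef → ∀ t ∈ Set.Icc (0 : ℝ) 1,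
    f (geodesic A B t) ≤ (1 - t) * f A + t * f B

/-- The objective `X ↦ ⟨S, X⁻¹⟩ + log det X`, with the inner product `⟨A, B⟩ = tr (Aᵀ B)`. -/
noncomputable def objective (S X : Matrix (Fin n) (Fin n) ℝ) : ℝ :=
  (Sᵀ * X⁻¹).trace + Real.log X.det

end FisherRao

open NormedSpace Filter Topology
open scoped Matrix.Norms.Operator

namespace FisherRao

/-! ### The matrix exponential on symmetric matrices, its derivative and its smooth inverse. -/

section Exponential

variable {m : ℕ}

/-! The ball is convex because distance to a fixed point `C` is geodesically convex, a consequence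
of nonpositive curvature that is verified here by explicit computation. Take nearly shortest smooth
curves `c₁`, `c₂` from `A` and `B` to `C`, and join `c₁ s` to `c₂ s` by a geodesic for each `s`. For
fixed `t` the time-`t` points form a curve ending at `C`. Its velocity, viewed as a function of `t`,
is a Jacobi field along the joining geodesic, so its norm is convex in `t`; integrating over `s`
bounds the length by `(1 - t) * length c₁ + t * length c₂` (`geodesic_variation`,
`dist_geodesic_le`).

For the convexity of the norm, write the geodesic as `P exp(tL) Pᵀ` and split the variation of `L`
into a part commuting with `L` and a commutator; the derivative of `exp` is explicit on each. In an
eigenbasis of `L` the normalised entries of the field are `a e^{-tθ} + b e^{tθ} + t g` with `g = 0`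
unless `θ = 0`. Each has convex absolute value, and Minkowski's inequality concludes
(`sqrt_metric_variation_le`). The same splitting shows that `exp` is locally invertible at symmetric
matrices, which gives smoothness of the variation (`exists_smooth_log`).

For the objective, one congruence turns the geodesic into `diag(e^{t lᵢ})`: the trace term becomes a
nonnegative combination of the `e^{-t lᵢ}`, and `log det` becomes affine in `t`. -/

theorem exists_orthogonal_diagonalization {L : Matrix (Fin m) (Fin m) ℝ} (hL : L.IsHermitian) :
    ∃ (U : Matrix (Fin m) (Fin m) ℝ) (l : Fin m → ℝ),
      Uᵀ * U = 1 ∧ U * Uᵀ = 1 ∧ L = U * Matrix.diagonal l * Uᵀ := by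
  refine ⟨hL.eigenvectorUnitary, hL.eigenvalues, ?_, ?_, ?_⟩
  · exact (Matrix.mem_unitaryGroup_iff').1 hL.eigenvectorUnitary.2
  · exact (Matrix.mem_unitaryGroup_iff).1 hL.eigenvectorUnitary.2
  · exact hL.spectral_theorem

theorem exp_conj_of_mul_eq_one {U V : Matrix (Fin m) (Fin m) ℝ} (h : U * V = 1)
    (X : Matrix (Fin m) (Fin m) ℝ) : exp (U * X * V) = U * exp X * V := by
  have hV : U⁻¹ = V := Matrix.inv_eq_right_inv h
  have hu : IsUnit U := (Matrix.isUnit_iff_isUnit_det U).2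
    (Matrix.isUnit_det_of_right_inverse h)
  have := Matrix.exp_conj U X hu
  rwa [hV] at this

theorem exp_orthogonal_diagonal {U : Matrix (Fin m) (Fin m) ℝ} (h : U * Uᵀ = 1)
    (l : Fin m → ℝ) :
    exp (U * Matrix.diagonal l * Uᵀ) = U * Matrix.diagonal (fun i => Real.exp (l i)) * Uᵀ := by
  rw [exp_conj_of_mul_eq_one h, Matrix.exp_diagonal]
  congr 3
  ext i
  rw [Pi.coe_exp, Real.exp_eq_exp_ℝ]

/-- A matrix is the sum of a part commuting with the symmetric matrix `L` and a commutator
with `L`. -/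
theorem exists_commuting_add_commutator {L : Matrix (Fin m) (Fin m) ℝ} (hL : L.IsHermitian)
    (H : Matrix (Fin m) (Fin m) ℝ) :
    ∃ H₀ K : Matrix (Fin m) (Fin m) ℝ, Commute L H₀ ∧ H = H₀ + (L * K - K * L) ∧
      (Hᵀ = H → H₀ᵀ = H₀ ∧ Kᵀ = -K) := by
  obtain ⟨U, l, hU, hU', rfl⟩ := exists_orthogonal_diagonalization hL
  set G := Uᵀ * H * U with hG
  -- In the eigenbasis, the commutator with `L` multiplies entry `(i, j)` by `l i - l j`: entries
  -- with equal eigenvalues commute with `L`, the others are divided by the difference.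
  set G₀ : Matrix (Fin m) (Fin m) ℝ := Matrix.of fun i j => if l i = l j then G i j else 0 with hG₀
  set K : Matrix (Fin m) (Fin m) ℝ :=
    Matrix.of fun i j => if l i = l j then 0 else G i j / (l i - l j) with hK
  have hcomm : Matrix.diagonal l * G₀ = G₀ * Matrix.diagonal l := by
    ext i j
    simp only [Matrix.diagonal_mul, Matrix.mul_diagonal, hG₀, Matrix.of_apply]
    split_ifs with h
    · rw [h, mul_comm]
    · simp
  have hsum : G = G₀ + (Matrix.diagonal l * K - K * Matrix.diagonal l) := by
    ext i j
    simp only [Matrix.add_apply, Matrix.sub_apply, Matrix.diagonal_mul, Matrix.mul_diagonal, hG₀,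
      hK, Matrix.of_apply]
    split_ifs with h
    · simp
    · have : l i - l j ≠ 0 := sub_ne_zero.2 h
      field_simp
      ring
  have hH : H = U * G * Uᵀ := by
    calc H = (U * Uᵀ) * H * (U * Uᵀ) := by simp [hU']
      _ = _ := by simp only [hG, Matrix.mul_assoc]
  have key : ∀ X Y : Matrix (Fin m) (Fin m) ℝ,
      (U * X * Uᵀ) * (U * Y * Uᵀ) = U * (X * Y) * Uᵀ := fun X Y => by
    calc _ = U * X * (Uᵀ * U) * Y * Uᵀ := by simp only [Matrix.mul_assoc]
      _ = _ := by simp only [hU, Matrix.mul_one, Matrix.mul_assoc]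
  refine ⟨U * G₀ * Uᵀ, U * K * Uᵀ, ?_, ?_, fun hsymm => ?_⟩
  · rw [commute_iff_eq, key, key, hcomm]
  · rw [key, key, ← Matrix.sub_mul, ← Matrix.mul_sub, ← Matrix.add_mul, ← Matrix.mul_add, ← hsum,
      ← hH]
  · have hGs : ∀ i j, G j i = G i j := fun i j => by
      have : Gᵀ = G := by
        simp only [hG, Matrix.transpose_mul, Matrix.transpose_transpose, hsymm, Matrix.mul_assoc]
      exact congrFun (congrFun this i) j
    have h1 : G₀ᵀ = G₀ := by
      ext i j
      simp only [hG₀, Matrix.transpose_apply, Matrix.of_apply, hGs i j, eq_comm]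
    have h2 : Kᵀ = -K := by
      ext i j
      simp only [hK, Matrix.transpose_apply, Matrix.of_apply, hGs i j, Matrix.neg_apply,
        eq_comm (a := l j)]
      split_ifs with h
      · simp
      · rw [← neg_sub (l i), div_neg]
    constructor
    · simp only [Matrix.transpose_mul, Matrix.transpose_transpose, h1, Matrix.mul_assoc]
    · simp only [Matrix.transpose_mul, Matrix.transpose_transpose, h2, Matrix.mul_assoc,
        Matrix.neg_mul, Matrix.mul_neg]

theorem contDiff_matrix_exp : ContDiff ℝ ∞ (exp : Matrix (Fin m) (Fin m) ℝ → _) :=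
  contDiff_iff_contDiffAt.2 fun x => (exp_analytic (𝕂 := ℝ) x).contDiffAt

theorem hasFDerivAt_matrix_exp (L : Matrix (Fin m) (Fin m) ℝ) :
    HasFDerivAt (exp : Matrix (Fin m) (Fin m) ℝ → _) (fderiv ℝ exp L) L :=
  (exp_analytic (𝕂 := ℝ) L).differentiableAt.hasFDerivAt

/-- Along the line `L + s • H` the exponential factors as `exp L * exp (s • H)`. -/
theorem fderiv_exp_of_commute {L H : Matrix (Fin m) (Fin m) ℝ} (h : Commute L H) :
    fderiv ℝ exp L H = exp L * H := by
  have h1 : HasDerivAt (fun s : ℝ => L + s • H) H 0 := by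
    have := ((hasDerivAt_id (0 : ℝ)).smul_const H).const_add L
    rwa [one_smul] at this
  have h0 : L + (0 : ℝ) • H = L := by simp
  have h2 : HasDerivAt (fun s : ℝ => exp (L + s • H)) (fderiv ℝ exp L H) 0 := by
    have := hasFDerivAt_matrix_exp (L + (0 : ℝ) • H)
    have := this.comp_hasDerivAt (0 : ℝ) h1
    rwa [h0] at this
  have h3 : HasDerivAt (fun s : ℝ => exp L * exp (s • H)) (exp L * H) 0 := by
    have := (hasDerivAt_exp_smul_const (𝕂 := ℝ) H (0 : ℝ)).const_mul (exp L)
    rwa [zero_smul, exp_zero, one_mul] at this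
  refine h2.unique (h3.congr_of_eventuallyEq (Eventually.of_forall fun s => ?_))
  exact Matrix.exp_add_of_commute _ _ (h.smul_right s)

/-- The direction is the velocity at `0` of the conjugates `exp (-sK) L exp (sK)`, and `exp`
commutes with conjugation. -/
theorem fderiv_exp_commutator (L K : Matrix (Fin m) (Fin m) ℝ) :
    fderiv ℝ exp L (L * K - K * L) = exp L * K - K * exp L := by
  have hconj : ∀ X : Matrix (Fin m) (Fin m) ℝ,
      HasDerivAt (fun s : ℝ => exp (s • (-K)) * X * exp (s • K)) (X * K - K * X) 0 := fun X => by
    have h1 := hasDerivAt_exp_smul_const (𝕂 := ℝ) (-K) (0 : ℝ)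
    have h2 := hasDerivAt_exp_smul_const (𝕂 := ℝ) K (0 : ℝ)
    have := (h1.mul_const X).mul h2
    refine this.congr_deriv ?_
    rw [zero_smul, zero_smul, exp_zero, one_mul, one_mul, one_mul, mul_one, neg_mul,
      neg_add_eq_sub]
  have h2 : HasDerivAt (fun s : ℝ => exp (exp (s • (-K)) * L * exp (s • K)))
      (fderiv ℝ exp L (L * K - K * L)) 0 := by
    have h0 : exp ((0 : ℝ) • (-K)) * L * exp ((0 : ℝ) • K) = L := by simp
    have := hasFDerivAt_matrix_exp (exp ((0 : ℝ) • (-K)) * L * exp ((0 : ℝ) • K))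
    have := this.comp_hasDerivAt (0 : ℝ) (hconj L)
    rwa [h0] at this
  refine h2.unique ((hconj (exp L)).congr_of_eventuallyEq (Eventually.of_forall fun s => ?_))
  refine exp_conj_of_mul_eq_one ?_ L
  rw [← Matrix.exp_add_of_commute]
  · simp
  · exact (((Commute.refl K).neg_left).smul_left s).smul_right s

/-- In an eigenbasis, off-resonant entries of the commutator part are scaled by `exp (l i) - exp (l
j)`, which vanishes only if `l i = l j`. This is the hypothesis of the inverse function theorem
below. -/
theorem fderiv_exp_injective {L : Matrix (Fin m) (Fin m) ℝ} (hL : L.IsHermitian) :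
    Function.Injective (fderiv ℝ exp L) := by
  rw [injective_iff_map_eq_zero]
  intro H hH
  obtain ⟨H₀, K, hc, rfl, -⟩ := exists_commuting_add_commutator hL H
  rw [map_add, fderiv_exp_of_commute hc, fderiv_exp_commutator] at hH
  obtain ⟨U, l, hU, hU', rfl⟩ := exists_orthogonal_diagonalization hL
  rw [exp_orthogonal_diagonal hU'] at hH
  obtain ⟨G, hG⟩ : ∃ G, H₀ = U * G * Uᵀ := ⟨Uᵀ * H₀ * U, by
    calc H₀ = (U * Uᵀ) * H₀ * (U * Uᵀ) := by simp [hU']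
      _ = _ := by simp only [Matrix.mul_assoc]⟩
  obtain ⟨J, hJ⟩ : ∃ J, K = U * J * Uᵀ := ⟨Uᵀ * K * U, by
    calc K = (U * Uᵀ) * K * (U * Uᵀ) := by simp [hU']
      _ = _ := by simp only [Matrix.mul_assoc]⟩
  have key : ∀ X Y : Matrix (Fin m) (Fin m) ℝ,
      (U * X * Uᵀ) * (U * Y * Uᵀ) = U * (X * Y) * Uᵀ := fun X Y => by
    calc _ = U * X * (Uᵀ * U) * Y * Uᵀ := by simp only [Matrix.mul_assoc]
      _ = _ := by simp only [hU, Matrix.mul_one, Matrix.mul_assoc]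
  have cancel : ∀ X Y : Matrix (Fin m) (Fin m) ℝ, U * X * Uᵀ = U * Y * Uᵀ → X = Y := by
    intro X Y h
    have h' : ∀ Z, Uᵀ * (U * Z * Uᵀ) * U = Z := fun Z => by
      calc _ = (Uᵀ * U) * Z * (Uᵀ * U) := by simp only [Matrix.mul_assoc]
        _ = Z := by simp [hU]
    rw [← h' X, h, h' Y]
  rw [commute_iff_eq, hG, key, key] at hc
  have hc := cancel _ _ hc
  rw [hG, hJ, key, key, key, ← Matrix.sub_mul, ← Matrix.mul_sub, ← Matrix.add_mul,
    ← Matrix.mul_add] at hH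
  have hH := cancel _ 0 (hH.trans (by simp))
  rw [hG, hJ, key, key, ← Matrix.sub_mul, ← Matrix.mul_sub, ← Matrix.add_mul, ← Matrix.mul_add]
  suffices G + (Matrix.diagonal l * J - J * Matrix.diagonal l) = 0 by rw [this]; simp
  ext i j
  have e1 := congrFun (congrFun hc i) j
  have e2 := congrFun (congrFun hH i) j
  simp only [Matrix.add_apply, Matrix.sub_apply, Matrix.diagonal_mul, Matrix.mul_diagonal,
    Matrix.zero_apply] at e1 e2 ⊢
  by_cases h : l i = l j
  · rw [h] at e2 ⊢
    have : Real.exp (l j) * G i j = 0 := by linarith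
    have := (mul_eq_zero.1 this).resolve_left (Real.exp_pos _).ne'
    rw [this]; ring
  · have hG0 : G i j = 0 := by
      have : (l i - l j) * G i j = 0 := by linarith
      exact (mul_eq_zero.1 this).resolve_left (sub_ne_zero.2 h)
    have hJ0 : J i j = 0 := by
      have : (Real.exp (l i) - Real.exp (l j)) * J i j = 0 := by rw [hG0] at e2; linarith
      exact (mul_eq_zero.1 this).resolve_left
        (sub_ne_zero.2 fun h' => h (Real.exp_injective h'))
    rw [hG0, hJ0]; ring

theorem cfc_exp_eq_exp {L : Matrix (Fin m) (Fin m) ℝ} (hL : L.IsHermitian) :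
    cfc Real.exp L = exp L :=
  -- The functional calculus is restated over the ring and topology coming from the operator norm,
  -- the structures used by `NormedSpace.exp`.
  letI : @ContinuousFunctionalCalculus ℝ (Matrix (Fin m) (Fin m) ℝ) IsSelfAdjoint _ _ _ _ _
      (Matrix.linftyOpNormedRing.toRing) (Matrix.instStarRing)
      (PseudoMetricSpace.toUniformSpace.toTopologicalSpace)
      (Matrix.linftyOpNormedAlgebra.toAlgebra) :=
    Matrix.IsHermitian.instContinuousFunctionalCalculus
  CFC.real_exp_eq_normedSpace_exp (A := Matrix (Fin m) (Fin m) ℝ) (a := L) hL.isSelfAdjoint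

theorem continuousOn_spectrum (L : Matrix (Fin m) (Fin m) ℝ) (f : ℝ → ℝ) :
    ContinuousOn f (spectrum ℝ L) :=
  (Matrix.finite_real_spectrum (A := L)).continuousOn f

theorem cfc_exp {L : Matrix (Fin m) (Fin m) ℝ} (hL : L.IsHermitian) (f : ℝ → ℝ) :
    cfc f (exp L) = cfc (fun x => f (Real.exp x)) L := by
  rw [← cfc_exp_eq_exp hL]
  exact (cfc_comp' f Real.exp L
    (((Matrix.finite_real_spectrum (A := L)).image _).continuousOn _)
    (continuousOn_spectrum L _) hL.isSelfAdjoint).symm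

theorem eq_of_exp_eq_exp {L M : Matrix (Fin m) (Fin m) ℝ} (hL : L.IsHermitian)
    (hM : M.IsHermitian) (h : exp L = exp M) : L = M := by
  have key : ∀ {X : Matrix (Fin m) (Fin m) ℝ}, X.IsHermitian → cfc Real.log (exp X) = X :=
    fun hX => by
      rw [cfc_exp hX]
      simp only [Real.log_exp]
      exact cfc_id' ℝ _ hX.isSelfAdjoint
  rw [← key hL, h, key hM]

theorem isHermitian_smul {L : Matrix (Fin m) (Fin m) ℝ} (hL : L.IsHermitian) (t : ℝ) :
    (t • L).IsHermitian := by
  rw [Matrix.IsHermitian, Matrix.conjTranspose_smul, hL.eq, star_trivial]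

theorem matPow_exp {L : Matrix (Fin m) (Fin m) ℝ} (hL : L.IsHermitian) (t : ℝ) :
    matPow (exp L) t = exp (t • L) := by
  rw [matPow, cfc_exp hL, ← cfc_exp_eq_exp (isHermitian_smul hL t),
    ← cfc_comp_smul t Real.exp L Real.continuous_exp.continuousOn hL.isSelfAdjoint]
  congr 1
  ext x
  rw [← Real.exp_mul, smul_eq_mul, mul_comm]

theorem exists_exp_eq {A : Matrix (Fin m) (Fin m) ℝ} (hA : A.PosDef) :
    ∃ L : Matrix (Fin m) (Fin m) ℝ, L.IsHermitian ∧ exp L = A := by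
  obtain ⟨U, hU, hU', h⟩ : ∃ U : Matrix (Fin m) (Fin m) ℝ, Uᵀ * U = 1 ∧ U * Uᵀ = 1 ∧
      A = U * Matrix.diagonal hA.1.eigenvalues * Uᵀ :=
    ⟨hA.1.eigenvectorUnitary, (Matrix.mem_unitaryGroup_iff').1 hA.1.eigenvectorUnitary.2,
      (Matrix.mem_unitaryGroup_iff).1 hA.1.eigenvectorUnitary.2, hA.1.spectral_theorem⟩
  refine ⟨U * Matrix.diagonal (fun i => Real.log (hA.1.eigenvalues i)) * Uᵀ, ?_, ?_⟩
  · rw [Matrix.IsHermitian, Matrix.conjTranspose_eq_transpose_of_trivial]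
    simp [Matrix.transpose_mul, Matrix.mul_assoc]
  · rw [exp_orthogonal_diagonal hU']
    conv_rhs => rw [h]
    congr 3
    ext i
    exact Real.exp_log (hA.eigenvalues_pos i)

theorem posDef_exp {L : Matrix (Fin m) (Fin m) ℝ} (hL : L.IsHermitian) : (exp L).PosDef := by
  obtain ⟨U, l, hU, hU', rfl⟩ := exists_orthogonal_diagonalization hL
  rw [exp_orthogonal_diagonal hU']
  have := (Matrix.PosDef.diagonal (d := fun i => Real.exp (l i)) fun i => Real.exp_pos _)
  have hu : IsUnit U := (Matrix.isUnit_iff_isUnit_det U).2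
    (Matrix.isUnit_det_of_right_inverse hU')
  exact (Matrix.IsUnit.posDef_star_right_conjugate_iff hu).2 this

/-- The symmetric logarithm of a smooth curve of positive definite matrices is smooth. -/
theorem exists_smooth_log {s : Set ℝ} {c : ℝ → Matrix (Fin m) (Fin m) ℝ}
    (hc : ContDiffOn ℝ ∞ c s) (hpos : ∀ x ∈ s, (c x).PosDef) :
    ∃ L : ℝ → Matrix (Fin m) (Fin m) ℝ, ContDiffOn ℝ ∞ L s ∧
      ∀ x ∈ s, (L x).IsHermitian ∧ exp (L x) = c x := by
  have hex : ∀ x, ∃ L : Matrix (Fin m) (Fin m) ℝ, x ∈ s → L.IsHermitian ∧ exp L = c x := fun x => by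
    by_cases h : x ∈ s
    · obtain ⟨L, hL⟩ := exists_exp_eq (hpos x h)
      exact ⟨L, fun _ => hL⟩
    · exact ⟨0, fun h' => absurd h' h⟩
  choose L hL using hex
  refine ⟨L, fun x hx => ?_, hL⟩
  obtain ⟨hLx, hexp⟩ := hL x hx
  -- In finite dimension the injective derivative is an isomorphism.
  let e : Matrix (Fin m) (Fin m) ℝ ≃L[ℝ] Matrix (Fin m) (Fin m) ℝ :=
    (LinearEquiv.ofInjectiveEndo (fderiv ℝ exp (L x)).toLinearMap
      (fderiv_exp_injective hLx)).toContinuousLinearEquiv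
  have he : HasFDerivAt (exp : Matrix (Fin m) (Fin m) ℝ → _)
      (e : Matrix (Fin m) (Fin m) ℝ →L[ℝ] Matrix (Fin m) (Fin m) ℝ) (L x) := by
    convert hasFDerivAt_matrix_exp (L x) using 1
    ext1 H
    rfl
  have hsm : ContDiffAt ℝ ∞ (exp : Matrix (Fin m) (Fin m) ℝ → _) (L x) :=
    contDiff_matrix_exp.contDiffAt
  have hstrict := hsm.hasStrictFDerivAt' he (by simp)
  set ψ := hstrict.localInverse exp e (L x) with hψ
  have hψs : ContDiffAt ℝ ∞ ψ (c x) := by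
    rw [← hexp]
    exact hsm.to_localInverse he (by simp)
  have hψx : ψ (c x) = L x := by
    rw [← hexp]
    exact hstrict.localInverse_apply_image
  refine (hψs.comp_contDiffWithinAt x (hc x hx)).congr_of_eventuallyEq ?_ hψx.symm
  have ht : Tendsto c (𝓝[s] x) (𝓝 (exp (L x))) := by
    rw [hexp]
    exact (hc x hx).continuousWithinAt
  have htψ : Tendsto (fun y => ψ (c y)) (𝓝[s] x) (𝓝 (L x)) := hstrict.localInverse_tendsto.comp ht
  -- The local inverse lives on all matrices, so its values must be shown symmetric. The transpose
  -- of `ψ (c y)` is another preimage of `c y` near `L x`, hence equal to it; injectivity of `exp`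
  -- on symmetric matrices then identifies it with `L y`.
  have htψ' : Tendsto (fun y => (ψ (c y))ᵀ) (𝓝[s] x) (𝓝 (L x)) := by
    have h1 : (L x)ᵀ = L x := hLx
    have h2 : Continuous fun X : Matrix (Fin m) (Fin m) ℝ => Xᵀ := continuous_id.matrix_transpose
    have := (h2.tendsto (L x)).comp htψ
    rwa [h1] at this
  filter_upwards [ht.eventually hstrict.eventually_right_inverse,
    htψ'.eventually hstrict.eventually_left_inverse, self_mem_nhdsWithin] with y h1 h2 hy
  obtain ⟨hLy, hexpy⟩ := hL y hy
  have hsym : (ψ (c y)).IsHermitian := by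
    have h3 : exp (ψ (c y))ᵀ = c y := by
      rw [Matrix.exp_transpose]
      change (exp (hstrict.localInverse exp e (L x) (c y)))ᵀ = c y
      rw [h1]
      exact (hpos y hy).1
    change hstrict.localInverse exp e (L x) (exp (ψ (c y))ᵀ) = (ψ (c y))ᵀ at h2
    rw [h3] at h2
    exact h2.symm
  exact eq_of_exp_eq_exp hLy hsym (hexpy.trans h1.symm)

end Exponential

/-! ### Convexity of the norm of a Jacobi field. -/

section Speed

variable {m : ℕ}

theorem sinh_mul_le {t x : ℝ} (ht : t ∈ Set.Icc (0 : ℝ) 1) (hx : 0 ≤ x) :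
    Real.sinh (t * x) ≤ t * Real.sinh x := by
  have hconv : ConvexOn ℝ (Set.Ici (0 : ℝ)) Real.sinh := by
    refine MonotoneOn.convexOn_of_deriv (convex_Ici 0) Real.continuous_sinh.continuousOn
      Real.differentiable_sinh.differentiableOn ?_
    rw [Real.deriv_sinh, interior_Ici]
    intro a ha b hb hab
    rw [Real.cosh_le_cosh, abs_of_pos ha, abs_of_pos hb]
    exact hab
  have := hconv.2 (Set.mem_Ici.2 hx) (Set.mem_Ici.2 le_rfl) ht.1 (sub_nonneg.2 ht.2)
    (by ring)
  simpa using this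

/-- The absolute value of a solution of `g'' = θ² g` is convex. -/
theorem abs_add_exp_le {t θ a b : ℝ} (ht : t ∈ Set.Icc (0 : ℝ) 1) :
    |a * Real.exp (-(t * θ)) + b * Real.exp (t * θ)| ≤
      (1 - t) * |a + b| + t * |a * Real.exp (-θ) + b * Real.exp θ| := by
  -- Changing the sign of `θ` exchanges `a` and `b`.
  wlog hθ : 0 ≤ θ generalizing θ a b
  · have := this (θ := -θ) (a := b) (b := a) (by linarith)
    simpa only [mul_neg, neg_neg, add_comm] using this
  rcases hθ.eq_or_lt with rfl | hθ
  · simp only [mul_zero, neg_zero, Real.exp_zero, mul_one]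
    apply le_of_eq
    ring
  have hs : 0 < Real.sinh θ := Real.sinh_pos_iff.2 hθ
  have ht' : 1 - t ∈ Set.Icc (0 : ℝ) 1 := ⟨by linarith [ht.2], by linarith [ht.1]⟩
  have h1 := sinh_mul_le ht' hθ.le
  have h2 := sinh_mul_le ht hθ.le
  have h1' : 0 ≤ Real.sinh ((1 - t) * θ) := Real.sinh_nonneg_iff.2 (mul_nonneg ht'.1 hθ.le)
  have h2' : 0 ≤ Real.sinh (t * θ) := Real.sinh_nonneg_iff.2 (mul_nonneg ht.1 hθ.le)
  -- The solution of `g'' = θ² g` recovered from its values at `0` and `1`.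
  have key : Real.sinh θ * (a * Real.exp (-(t * θ)) + b * Real.exp (t * θ)) =
      Real.sinh ((1 - t) * θ) * (a + b) +
        Real.sinh (t * θ) * (a * Real.exp (-θ) + b * Real.exp θ) := by
    have e1 : Real.exp ((1 - t) * θ) = Real.exp θ * Real.exp (-(t * θ)) := by
      rw [← Real.exp_add]; ring_nf
    have e2 : Real.exp (-((1 - t) * θ)) = Real.exp (-θ) * Real.exp (t * θ) := by
      rw [← Real.exp_add]; ring_nf
    rw [Real.sinh_eq, Real.sinh_eq, Real.sinh_eq, e1, e2]
    ring
  have h3 : Real.sinh θ * |a * Real.exp (-(t * θ)) + b * Real.exp (t * θ)| ≤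
      Real.sinh θ * ((1 - t) * |a + b| + t * |a * Real.exp (-θ) + b * Real.exp θ|) := by
    rw [← abs_of_pos hs, ← abs_mul, key, abs_of_pos hs]
    refine (abs_add_le _ _).trans ?_
    rw [abs_mul, abs_mul, abs_of_nonneg h1', abs_of_nonneg h2']
    nlinarith [mul_le_mul_of_nonneg_right h1 (abs_nonneg (a + b)),
      mul_le_mul_of_nonneg_right h2 (abs_nonneg (a * Real.exp (-θ) + b * Real.exp θ))]
  exact le_of_mul_le_mul_left h3 hs

theorem abs_jacobi_entry_le {t θ a b g : ℝ} (ht : t ∈ Set.Icc (0 : ℝ) 1) (hg : θ = 0 ∨ g = 0) :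
    |a * Real.exp (-(t * θ)) + b * Real.exp (t * θ) + t * g| ≤
      (1 - t) * |a + b| + t * |a * Real.exp (-θ) + b * Real.exp θ + g| := by
  rcases hg with rfl | rfl
  · simp only [mul_zero, neg_zero, Real.exp_zero, mul_one]
    have h1 : a + b + t * g = (1 - t) * (a + b) + t * (a + b + g) := by ring
    rw [h1]
    refine (abs_add_le _ _).trans (le_of_eq ?_)
    rw [abs_mul, abs_mul, abs_of_nonneg (sub_nonneg.2 ht.2), abs_of_nonneg ht.1]
  · simpa using abs_add_exp_le ht

/-- Minkowski's inequality in Euclidean space, passing from entrywise bounds to norms. -/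
theorem sqrt_sum_sq_le {ι : Type*} [Fintype ι] {f g h : ι → ℝ} {a b : ℝ} (ha : 0 ≤ a)
    (hb : 0 ≤ b) (hle : ∀ i, |f i| ≤ a * |g i| + b * |h i|) :
    √(∑ i, f i ^ 2) ≤ a * √(∑ i, g i ^ 2) + b * √(∑ i, h i ^ 2) := by
  have hn : ∀ k : ι → ℝ, √(∑ i, k i ^ 2) = ‖WithLp.toLp 2 (fun i => |k i|)‖ := fun k => by
    rw [EuclideanSpace.norm_eq]
    simp
  have h1 : √(∑ i, f i ^ 2) ≤
      ‖a • WithLp.toLp 2 (fun i => |g i|) + b • WithLp.toLp 2 (fun i => |h i|)‖ := by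
    rw [EuclideanSpace.norm_eq]
    apply Real.sqrt_le_sqrt
    apply Finset.sum_le_sum
    intro i _
    simp only [PiLp.add_apply, PiLp.smul_apply, smul_eq_mul, Real.norm_eq_abs, sq_abs]
    rw [← sq_abs (f i)]
    exact pow_le_pow_left₀ (abs_nonneg _) (hle i) 2
  refine h1.trans ((norm_add_le _ _).trans (le_of_eq ?_))
  rw [norm_smul, norm_smul, Real.norm_of_nonneg ha, Real.norm_of_nonneg hb, hn g, hn h]

/-- Congruence by `Q` is an isometry of the metric, so only the diagonal base point matters. -/
theorem metric_congr_diagonal {Q : Matrix (Fin m) (Fin m) ℝ} (hQ : IsUnit Q) {d : Fin m → ℝ}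
    (hd : ∀ i, d i ≠ 0) (J : Matrix (Fin m) (Fin m) ℝ) :
    metric (Q * Matrix.diagonal d * Qᵀ) (Q * J * Qᵀ) (Q * J * Qᵀ) =
      1 / 2 * ∑ i, ∑ j, J i j * J j i / (d i * d j) := by
  have hdet : IsUnit Q.det := (Matrix.isUnit_iff_isUnit_det Q).1 hQ
  have hdetT : IsUnit Qᵀ.det := by rwa [Matrix.det_transpose]
  have hdiag : (Matrix.diagonal d)⁻¹ = Matrix.diagonal fun i => (d i)⁻¹ := by
    apply Matrix.inv_eq_right_inv
    rw [Matrix.diagonal_mul_diagonal]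
    simp [hd]
  have h1 : (Q * J * Qᵀ) * (Q * Matrix.diagonal d * Qᵀ)⁻¹ =
      Q * (J * Matrix.diagonal fun i => (d i)⁻¹) * Q⁻¹ := by
    rw [Matrix.mul_inv_rev, Matrix.mul_inv_rev, hdiag]
    calc _ = Q * J * (Qᵀ * Qᵀ⁻¹) * ((Matrix.diagonal fun i => (d i)⁻¹) * Q⁻¹) := by
          simp only [Matrix.mul_assoc]
      _ = _ := by rw [Matrix.mul_nonsing_inv _ hdetT]; simp only [Matrix.mul_one, Matrix.mul_assoc]
  rw [metric, Matrix.mul_assoc _ (Q * J * Qᵀ), h1]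
  have h2 : ∀ X : Matrix (Fin m) (Fin m) ℝ, Q * X * Q⁻¹ * (Q * X * Q⁻¹) = Q * (X * X) * Q⁻¹ :=
    fun X => by
      calc _ = Q * X * (Q⁻¹ * Q) * X * Q⁻¹ := by simp only [Matrix.mul_assoc]
        _ = _ := by rw [Matrix.nonsing_inv_mul _ hdet]; simp only [Matrix.mul_one, Matrix.mul_assoc]
  rw [h2, Matrix.trace_mul_comm, ← Matrix.mul_assoc, Matrix.nonsing_inv_mul _ hdet, Matrix.one_mul,
    Matrix.trace]
  congr 1
  refine Finset.sum_congr rfl fun i _ => ?_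
  rw [Matrix.diag_apply, Matrix.mul_apply]
  refine Finset.sum_congr rfl fun j _ => ?_
  simp only [Matrix.mul_diagonal]
  field_simp

/-- The length of a Jacobi field along a geodesic is convex, in coordinates in which the geodesic
is `t ↦ diag (exp (t l))`. -/
theorem sqrt_metric_jacobi_le {Q V G : Matrix (Fin m) (Fin m) ℝ} {l : Fin m → ℝ} (hQ : IsUnit Q)
    (hG : Gᵀ = G) (hGl : ∀ i j, l i = l j ∨ G i j = 0) {γ J : ℝ → Matrix (Fin m) (Fin m) ℝ}
    (hγ : ∀ t, γ t = Q * Matrix.diagonal (fun i => Real.exp (t * l i)) * Qᵀ)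
    (hJ : ∀ t, J t = Q * (V * Matrix.diagonal (fun i => Real.exp (t * l i)) +
      Matrix.diagonal (fun i => Real.exp (t * l i)) * Vᵀ +
      Matrix.diagonal (fun i => Real.exp (t * l i)) * (t • G)) * Qᵀ)
    {t : ℝ} (ht : t ∈ Set.Icc (0 : ℝ) 1) :
    √(metric (γ t) (J t) (J t)) ≤
      (1 - t) * √(metric (γ 0) (J 0) (J 0)) + t * √(metric (γ 1) (J 1) (J 1)) := by
  -- Entries of the field divided by `exp (t * (l i + l j) / 2)`, the square root of the weight in
  -- the metric.
  set g : ℝ → Fin m × Fin m → ℝ := fun t p =>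
    V p.1 p.2 * Real.exp (-(t * ((l p.1 - l p.2) / 2))) +
      V p.2 p.1 * Real.exp (t * ((l p.1 - l p.2) / 2)) + t * G p.1 p.2 with hg
  have hm : ∀ t, √(metric (γ t) (J t) (J t)) = √(1 / 2) * √(∑ p, g t p ^ 2) := fun t => by
    rw [hγ, hJ, metric_congr_diagonal hQ (fun i => (Real.exp_pos _).ne'),
      Real.sqrt_mul (by norm_num), Fintype.sum_prod_type]
    congr 2
    refine Finset.sum_congr rfl fun i _ => Finset.sum_congr rfl fun j _ => ?_
    have hGs : G j i = G i j := congrFun (congrFun hG i) j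
    simp only [Matrix.add_apply, Matrix.mul_diagonal, Matrix.diagonal_mul, Matrix.transpose_apply,
      Matrix.smul_apply, smul_eq_mul, hGs, hg, Real.exp_neg]
    set x := Real.exp (t * ((l i - l j) / 2)) with hx
    have hx0 : x ≠ 0 := (Real.exp_pos _).ne'
    have e0 : Real.exp (t * l j) ≠ 0 := (Real.exp_pos _).ne'
    have e1 : Real.exp (t * l i) = Real.exp (t * l j) * x ^ 2 := by
      rw [hx, ← Real.exp_nat_mul, ← Real.exp_add]
      congr 1
      push_cast
      ring
    rw [e1]
    rcases hGl i j with h | h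
    · have : x = 1 := by rw [hx, h]; simp
      rw [this]
      field_simp
      ring
    · rw [h]
      field_simp
      ring
  rw [hm, hm, hm]
  have := sqrt_sum_sq_le (f := g t) (g := g 0) (h := g 1) (sub_nonneg.2 ht.2) ht.1 fun p => by
    have := abs_jacobi_entry_le (θ := (l p.1 - l p.2) / 2) (a := V p.1 p.2) (b := V p.2 p.1)
      (g := G p.1 p.2) ht ((hGl p.1 p.2).imp_left fun h => by rw [h]; simp)
    simpa [hg] using this
  calc _ ≤ √(1 / 2) * ((1 - t) * √(∑ p, g 0 p ^ 2) + t * √(∑ p, g 1 p ^ 2)) :=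
        mul_le_mul_of_nonneg_left this (Real.sqrt_nonneg _)
    _ = _ := by ring

/-- The length of the variation field of the geodesics `t ↦ P exp (t L) Pᵀ` is convex in `t`. -/
theorem sqrt_metric_variation_le {P L P' L' : Matrix (Fin m) (Fin m) ℝ} (hP : IsUnit P)
    (hL : L.IsHermitian) (hL' : L'ᵀ = L') {γ J : ℝ → Matrix (Fin m) (Fin m) ℝ}
    (hγ : ∀ t, γ t = P * exp (t • L) * Pᵀ)
    (hJ : ∀ t, J t = (P' * exp (t • L) + P * fderiv ℝ exp (t • L) (t • L')) * Pᵀ +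
      P * exp (t • L) * P'ᵀ) {t : ℝ} (ht : t ∈ Set.Icc (0 : ℝ) 1) :
    √(metric (γ t) (J t) (J t)) ≤
      (1 - t) * √(metric (γ 0) (J 0) (J 0)) + t * √(metric (γ 1) (J 1) (J 1)) := by
  obtain ⟨H, K, hc, hHK, hs⟩ := exists_commuting_add_commutator hL L'
  obtain ⟨hH, hK⟩ := hs hL'
  obtain ⟨U, l, hU, hU', hLU⟩ := exists_orthogonal_diagonalization hL
  have hdet : IsUnit P.det := (Matrix.isUnit_iff_isUnit_det P).1 hP
  have hexp : ∀ t : ℝ, exp (t • L) = U * Matrix.diagonal (fun i => Real.exp (t * l i)) * Uᵀ :=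
    fun t => by
      have h1 : t • L = U * Matrix.diagonal (fun i => t * l i) * Uᵀ := by
        rw [hLU, ← Matrix.smul_mul, ← Matrix.mul_smul, ← Matrix.diagonal_smul]
        rfl
      rw [h1, exp_orthogonal_diagonal hU']
  have hfd : ∀ t : ℝ, fderiv ℝ exp (t • L) (t • L') =
      exp (t • L) * (t • H) + (exp (t • L) * K - K * exp (t • L)) := fun t => by
    have h1 : t • L' = t • H + ((t • L) * K - K * (t • L)) := by
      rw [hHK, smul_add, smul_sub, Matrix.smul_mul, Matrix.mul_smul]
    rw [h1, map_add, fderiv_exp_of_commute ((hc.smul_left t).smul_right t), fderiv_exp_commutator]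
  -- The commutator part `K` of the variation of `L` is absorbed into the variation of `P`, using
  -- `Kᵀ = -K`; only `H` contributes a term linear in `t`.
  set W := P⁻¹ * P' - K with hW
  have hP' : P' = P * (W + K) := by
    rw [hW, sub_add_cancel, ← Matrix.mul_assoc, Matrix.mul_nonsing_inv _ hdet, Matrix.one_mul]
  have hUu : IsUnit U := (Matrix.isUnit_iff_isUnit_det U).2
    (Matrix.isUnit_det_of_right_inverse hU')
  have hcd : ∀ i j, l i = l j ∨ (Uᵀ * H * U) i j = 0 := by
    have h1 : Matrix.diagonal l * (Uᵀ * H * U) = (Uᵀ * H * U) * Matrix.diagonal l := by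
      have h2 : Matrix.diagonal l = Uᵀ * L * U := by
        rw [hLU]
        calc _ = (Uᵀ * U) * Matrix.diagonal l * (Uᵀ * U) := by simp [hU]
          _ = _ := by simp only [Matrix.mul_assoc]
      rw [h2]
      calc _ = Uᵀ * L * (U * Uᵀ) * H * U := by simp only [Matrix.mul_assoc]
        _ = Uᵀ * (L * H) * U := by rw [hU']; simp only [Matrix.mul_one, Matrix.mul_assoc]
        _ = Uᵀ * H * (U * Uᵀ) * L * U := by
          rw [hc.eq, hU']; simp only [Matrix.mul_one, Matrix.mul_assoc]
        _ = _ := by simp only [Matrix.mul_assoc]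
    intro i j
    have h2 := congrFun (congrFun h1 i) j
    rw [Matrix.diagonal_mul, Matrix.mul_diagonal] at h2
    have h3 : (l i - l j) * (Uᵀ * H * U) i j = 0 := by linarith
    exact (mul_eq_zero.1 h3).imp_left sub_eq_zero.1
  refine sqrt_metric_jacobi_le (Q := P * U) (V := Uᵀ * W * U) (G := Uᵀ * H * U) (l := l)
    (hP.mul hUu) ?_ hcd (fun t => ?_) (fun t => ?_) ht
  · simp only [Matrix.transpose_mul, Matrix.transpose_transpose, hH, Matrix.mul_assoc]
  · rw [hγ, hexp, Matrix.transpose_mul]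
    simp only [Matrix.mul_assoc]
  · have h1 : J t = P * (W * exp (t • L) + exp (t • L) * Wᵀ + exp (t • L) * (t • H)) * Pᵀ := by
      rw [hJ, hfd, hP', Matrix.transpose_mul, Matrix.transpose_add, hK]
      noncomm_ring
    have h2 : ∀ X : Matrix (Fin m) (Fin m) ℝ, U * (Uᵀ * X) = X := fun X => by
      rw [← Matrix.mul_assoc, hU', Matrix.one_mul]
    rw [h1, hexp]
    simp only [Matrix.transpose_mul, Matrix.transpose_transpose, Matrix.mul_add, Matrix.add_mul,
      Matrix.mul_assoc, h2, Matrix.mul_smul, Matrix.smul_mul]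

end Speed

/-! ### Lengths of curves, geodesic variations, and convexity of balls. -/

section Curves

variable {m : ℕ}

/-- The continuous linear functional extracting an entry of a matrix. -/
noncomputable def entryCLM (i j : Fin m) : Matrix (Fin m) (Fin m) ℝ →L[ℝ] ℝ :=
  LinearMap.toContinuousLinearMap (Matrix.entryLinearMap ℝ ℝ i j)

theorem contDiffOn_matrix_iff {c : ℝ → Matrix (Fin m) (Fin m) ℝ} {s : Set ℝ} :
    ContDiffOn ℝ ∞ c s ↔ ∀ i j, ContDiffOn ℝ ∞ (fun t => c t i j) s := by
  refine ⟨fun h i j => (entryCLM i j).contDiff.comp_contDiffOn h, fun h => ?_⟩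
  have h1 : c = fun t => ∑ i, ∑ j, c t i j • Matrix.single i j (1 : ℝ) := by
    funext t
    conv_lhs => rw [Matrix.matrix_eq_sum_single (c t)]
    simp [Matrix.smul_single]
  rw [h1]
  exact ContDiffOn.sum fun i _ => ContDiffOn.sum fun j _ => (h i j).smul contDiffOn_const

theorem velocity_eq {c : ℝ → Matrix (Fin m) (Fin m) ℝ} {c' : Matrix (Fin m) (Fin m) ℝ} {s : ℝ}
    (hs : s ∈ Set.Icc (0 : ℝ) 1) (h : HasDerivWithinAt c c' (Set.Icc 0 1) s) :
    velocity c s = c' := by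
  ext i j
  exact ((entryCLM i j).hasFDerivAt.comp_hasDerivWithinAt s h).derivWithin
    (uniqueDiffOn_Icc zero_lt_one s hs)

theorem matrix_inv_exp (X : Matrix (Fin m) (Fin m) ℝ) : (exp X)⁻¹ = exp (-X) :=
  (Matrix.exp_neg X).symm

/-- Supplies the integrability needed to compare lengths; continuity of the inverse comes from `exp
(-L)` with `L` the smooth logarithm. -/
theorem continuousOn_speed {A B : Matrix (Fin m) (Fin m) ℝ} {c : ℝ → Matrix (Fin m) (Fin m) ℝ}
    (hc : IsSmoothCurve A B c) :
    ContinuousOn (fun t => √(metric (c t) (velocity c t) (velocity c t))) (Set.Icc 0 1) := by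
  have hsm := contDiffOn_matrix_iff.2 hc.smooth
  obtain ⟨L, hL, hexp⟩ := exists_smooth_log hsm hc.posDef
  have hv : ContinuousOn (velocity c) (Set.Icc 0 1) :=
    (hsm.continuousOn_derivWithin (uniqueDiffOn_Icc zero_lt_one) (by simp)).congr fun s hs =>
      velocity_eq hs ((hsm.differentiableOn (by simp)) s hs).hasDerivWithinAt
  have hi : ContinuousOn (fun t => (c t)⁻¹) (Set.Icc 0 1) :=
    (contDiff_matrix_exp.continuous.comp_continuousOn hL.neg.continuousOn).congr fun s hs => by
      rw [← (hexp s hs).2, matrix_inv_exp]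
      rfl
  have htr : Continuous fun X : Matrix (Fin m) (Fin m) ℝ => X.trace := continuous_id.matrix_trace
  exact (continuousOn_const.mul
    (htr.comp_continuousOn (((hv.mul hi).mul hv).mul hi))).sqrt

theorem length_nonneg (c : ℝ → Matrix (Fin m) (Fin m) ℝ) : 0 ≤ length c :=
  intervalIntegral.integral_nonneg zero_le_one fun _ _ => Real.sqrt_nonneg _

theorem dist_le_length {A B : Matrix (Fin m) (Fin m) ℝ} {c : ℝ → Matrix (Fin m) (Fin m) ℝ}
    (hc : IsSmoothCurve A B c) : dist A B ≤ length c :=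
  csInf_le ⟨0, fun l hl => by obtain ⟨c, -, rfl⟩ := hl; exact length_nonneg c⟩ ⟨c, hc, rfl⟩

theorem exists_isSmoothCurve {A B : Matrix (Fin m) (Fin m) ℝ} (hA : A.PosDef) (hB : B.PosDef) :
    ∃ c, IsSmoothCurve A B c := by
  -- The straight segment stays in the convex cone of positive definite matrices.
  refine ⟨fun t => (1 - t) • A + t • B, fun i j => ?_, fun t ht => ?_, by simp, by simp⟩
  · simp only [Matrix.add_apply, Matrix.smul_apply]
    fun_prop
  · rcases ht.1.eq_or_lt with rfl | h0
    · simpa using hA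
    · exact Matrix.PosDef.posSemidef_add (hA.posSemidef.smul (sub_nonneg.2 ht.2)) (hB.smul h0)

theorem exists_length_lt {A B : Matrix (Fin m) (Fin m) ℝ} (hA : A.PosDef) (hB : B.PosDef) {r : ℝ}
    (h : dist A B < r) : ∃ c, IsSmoothCurve A B c ∧ length c < r := by
  obtain ⟨c₀, hc₀⟩ := exists_isSmoothCurve hA hB
  have hne : {l : ℝ | ∃ c : ℝ → Matrix (Fin m) (Fin m) ℝ, IsSmoothCurve A B c ∧
      l = length c}.Nonempty := ⟨_, c₀, hc₀, rfl⟩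
  obtain ⟨_, ⟨c, hc, rfl⟩, hlt⟩ := exists_lt_of_csInf_lt hne h
  exact ⟨c, hc, hlt⟩

theorem isUnit_matrix_exp (X : Matrix (Fin m) (Fin m) ℝ) : IsUnit (exp X) :=
  Matrix.isUnit_exp X

theorem posDef_conj_of_isHermitian {X P : Matrix (Fin m) (Fin m) ℝ} (hX : X.PosDef)
    (hP : P.IsHermitian) (hu : IsUnit P) : (P * X * P).PosDef := by
  have h : star P = P := hP
  have := (Matrix.IsUnit.posDef_star_right_conjugate_iff hu).2 hX
  rwa [h] at this

theorem exp_half_mul_exp_half (a : Matrix (Fin m) (Fin m) ℝ) :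
    exp ((1 / 2 : ℝ) • a) * exp ((1 / 2 : ℝ) • a) = exp a := by
  rw [← Matrix.exp_add_of_commute _ _ (Commute.refl _), ← add_smul]
  norm_num

theorem exp_half_mul_exp_neg_half (a : Matrix (Fin m) (Fin m) ℝ) :
    exp ((1 / 2 : ℝ) • a) * exp ((-(1 / 2) : ℝ) • a) = 1 := by
  rw [← Matrix.exp_add_of_commute _ _ (((Commute.refl a).smul_left _).smul_right _), ← add_smul]
  norm_num

theorem exp_neg_half_mul_exp_half (a : Matrix (Fin m) (Fin m) ℝ) :
    exp ((-(1 / 2) : ℝ) • a) * exp ((1 / 2 : ℝ) • a) = 1 := by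
  rw [← Matrix.exp_add_of_commute _ _ (((Commute.refl a).smul_left _).smul_right _), ← add_smul]
  norm_num

theorem geodesic_exp {a L B : Matrix (Fin m) (Fin m) ℝ} (ha : a.IsHermitian) (hL : L.IsHermitian)
    (h : exp L = exp ((-(1 / 2) : ℝ) • a) * B * exp ((-(1 / 2) : ℝ) • a)) (t : ℝ) :
    geodesic (exp a) B t = exp ((1 / 2 : ℝ) • a) * exp (t • L) * exp ((1 / 2 : ℝ) • a) := by
  rw [geodesic, matPow_exp ha, matPow_exp ha, ← h, matPow_exp hL]

theorem geodesic_exp_zero {a L B : Matrix (Fin m) (Fin m) ℝ} (ha : a.IsHermitian)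
    (hL : L.IsHermitian)
    (h : exp L = exp ((-(1 / 2) : ℝ) • a) * B * exp ((-(1 / 2) : ℝ) • a)) :
    geodesic (exp a) B 0 = exp a := by
  rw [geodesic_exp ha hL h, zero_smul, exp_zero, Matrix.mul_one, exp_half_mul_exp_half]

theorem geodesic_exp_one {a L B : Matrix (Fin m) (Fin m) ℝ} (ha : a.IsHermitian)
    (hL : L.IsHermitian)
    (h : exp L = exp ((-(1 / 2) : ℝ) • a) * B * exp ((-(1 / 2) : ℝ) • a)) :
    geodesic (exp a) B 1 = B := by
  rw [geodesic_exp ha hL h, one_smul, h]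
  calc _ = (exp ((1 / 2 : ℝ) • a) * exp ((-(1 / 2) : ℝ) • a)) * B *
        (exp ((-(1 / 2) : ℝ) • a) * exp ((1 / 2 : ℝ) • a)) := by simp only [Matrix.mul_assoc]
    _ = B := by
      rw [exp_half_mul_exp_neg_half, exp_neg_half_mul_exp_half, Matrix.one_mul, Matrix.mul_one]

theorem exists_geodesic_data {A B : Matrix (Fin m) (Fin m) ℝ} (hA : A.PosDef) (hB : B.PosDef) :
    ∃ a L : Matrix (Fin m) (Fin m) ℝ, a.IsHermitian ∧ L.IsHermitian ∧ exp a = A ∧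
      exp L = exp ((-(1 / 2) : ℝ) • a) * B * exp ((-(1 / 2) : ℝ) • a) := by
  obtain ⟨a, ha, rfl⟩ := exists_exp_eq hA
  obtain ⟨L, hL, h⟩ := exists_exp_eq (posDef_conj_of_isHermitian hB
    (isHermitian_smul ha (-(1 / 2))).exp (isUnit_matrix_exp _))
  exact ⟨a, L, ha, hL, rfl, h⟩

theorem posDef_geodesic {A B : Matrix (Fin m) (Fin m) ℝ} (hA : A.PosDef) (hB : B.PosDef) (t : ℝ) :
    (geodesic A B t).PosDef := by
  obtain ⟨a, L, ha, hL, rfl, h⟩ := exists_geodesic_data hA hB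
  rw [geodesic_exp ha hL h]
  exact posDef_conj_of_isHermitian (posDef_exp (isHermitian_smul hL t))
    (isHermitian_smul ha _).exp (isUnit_matrix_exp _)

theorem geodesic_zero {A B : Matrix (Fin m) (Fin m) ℝ} (hA : A.PosDef) (hB : B.PosDef) :
    geodesic A B 0 = A := by
  obtain ⟨a, L, ha, hL, rfl, h⟩ := exists_geodesic_data hA hB
  exact geodesic_exp_zero ha hL h

theorem geodesic_one {A B : Matrix (Fin m) (Fin m) ℝ} (hA : A.PosDef) (hB : B.PosDef) :
    geodesic A B 1 = B := by
  obtain ⟨a, L, ha, hL, rfl, h⟩ := exists_geodesic_data hA hB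
  exact geodesic_exp_one ha hL h

/-- Ensures that the variation between two curves ending at `C` also ends at `C`. -/
theorem geodesic_self {A : Matrix (Fin m) (Fin m) ℝ} (hA : A.PosDef) (t : ℝ) :
    geodesic A A t = A := by
  obtain ⟨a, ha, rfl⟩ := exists_exp_eq hA
  have h : exp (0 : Matrix (Fin m) (Fin m) ℝ) =
      exp ((-(1 / 2) : ℝ) • a) * exp a * exp ((-(1 / 2) : ℝ) • a) := by
    rw [exp_zero, ← exp_half_mul_exp_half a, ← Matrix.mul_assoc, exp_neg_half_mul_exp_half,
      Matrix.one_mul, exp_half_mul_exp_neg_half]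
  rw [geodesic_exp ha Matrix.isHermitian_zero h, smul_zero, exp_zero, Matrix.mul_one,
    exp_half_mul_exp_half]

/-- The geodesics between two smooth curves form a smooth variation whose speed is convex along
the geodesics. -/
theorem geodesic_variation {A B C : Matrix (Fin m) (Fin m) ℝ}
    {c₁ c₂ : ℝ → Matrix (Fin m) (Fin m) ℝ} (h₁ : IsSmoothCurve A C c₁)
    (h₂ : IsSmoothCurve B C c₂) {t : ℝ} (ht : t ∈ Set.Icc (0 : ℝ) 1) :
    IsSmoothCurve (geodesic A B t) C (fun s => geodesic (c₁ s) (c₂ s) t) ∧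
      ∀ s ∈ Set.Icc (0 : ℝ) 1,
        √(metric (geodesic (c₁ s) (c₂ s) t) (velocity (fun s => geodesic (c₁ s) (c₂ s) t) s)
            (velocity (fun s => geodesic (c₁ s) (c₂ s) t) s)) ≤
          (1 - t) * √(metric (c₁ s) (velocity c₁ s) (velocity c₁ s)) +
            t * √(metric (c₂ s) (velocity c₂ s) (velocity c₂ s)) := by
  have hs₁ := contDiffOn_matrix_iff.2 h₁.smooth
  have hs₂ := contDiffOn_matrix_iff.2 h₂.smooth
  obtain ⟨a, ha, hae⟩ := exists_smooth_log hs₁ h₁.posDef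
  have hsexp : ∀ r : ℝ, ContDiffOn ℝ ∞ (fun s => exp (r • a s)) (Set.Icc 0 1) := fun r =>
    contDiff_matrix_exp.comp_contDiffOn (ha.const_smul r)
  -- With `a` and `L` smooth in `s`, the geodesic is a product of exponentials of smooth curves.
  obtain ⟨L, hL, hLe⟩ := exists_smooth_log (((hsexp (-(1 / 2))).mul hs₂).mul (hsexp (-(1 / 2))))
    fun s hs => posDef_conj_of_isHermitian (h₂.posDef s hs)
      (isHermitian_smul (hae s hs).1 (-(1 / 2))).exp (isUnit_matrix_exp _)
  have hgeo : ∀ s ∈ Set.Icc (0 : ℝ) 1, ∀ t : ℝ, geodesic (c₁ s) (c₂ s) t =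
      exp ((1 / 2 : ℝ) • a s) * exp (t • L s) * exp ((1 / 2 : ℝ) • a s) := fun s hs t => by
    rw [← geodesic_exp (hae s hs).1 (hLe s hs).1 (hLe s hs).2, (hae s hs).2]
  refine ⟨⟨contDiffOn_matrix_iff.1 ?_, ?_, ?_, ?_⟩, fun s hs => ?_⟩
  · exact (((hsexp (1 / 2)).mul (contDiff_matrix_exp.comp_contDiffOn (hL.const_smul t))).mul
      (hsexp (1 / 2))).congr fun s hs => hgeo s hs t
  · exact fun s hs => posDef_geodesic (h₁.posDef s hs) (h₂.posDef s hs) t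
  · rw [h₁.source, h₂.source]
  · have hC := h₁.posDef 1 (by simp)
    rw [h₁.target] at hC
    rw [h₁.target, h₂.target, geodesic_self hC]
  set P := fun s => exp ((1 / 2 : ℝ) • a s) with hP
  have hPd : HasDerivWithinAt P (derivWithin P (Set.Icc 0 1) s) (Set.Icc 0 1) s :=
    (((hsexp (1 / 2)).differentiableOn (by simp)) s hs).hasDerivWithinAt
  have hLd : HasDerivWithinAt L (derivWithin L (Set.Icc 0 1) s) (Set.Icc 0 1) s :=
    ((hL.differentiableOn (by simp)) s hs).hasDerivWithinAt
  set P' := derivWithin P (Set.Icc 0 1) s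
  set L' := derivWithin L (Set.Icc 0 1) s
  have hsymm : ∀ {F : ℝ → Matrix (Fin m) (Fin m) ℝ} {F' : Matrix (Fin m) (Fin m) ℝ},
      (∀ u ∈ Set.Icc (0 : ℝ) 1, (F u)ᵀ = F u) → HasDerivWithinAt F F' (Set.Icc 0 1) s →
      F'ᵀ = F' := fun {F F'} hF hd => by
    have e : ∀ i j, F' i j = derivWithin (fun u => F u i j) (Set.Icc 0 1) s := fun i j => by
      rw [← velocity_eq hs hd]
      rfl
    ext i j
    rw [Matrix.transpose_apply, e, e]
    exact derivWithin_congr (fun u hu => congrFun (congrFun (hF u hu) i) j)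
      (congrFun (congrFun (hF s hs) i) j)
  have hPt : ∀ u ∈ Set.Icc (0 : ℝ) 1, (P u)ᵀ = P u := fun u hu =>
    (isHermitian_smul (hae u hu).1 (1 / 2)).exp
  have hP't : P'ᵀ = P' := hsymm hPt hPd
  have hL't : L'ᵀ = L' := hsymm (fun u hu => (hLe u hu).1) hLd
  have hvel : ∀ r : ℝ, velocity (fun s => geodesic (c₁ s) (c₂ s) r) s =
      (P' * exp (r • L s) + P s * fderiv ℝ exp (r • L s) (r • L')) * (P s)ᵀ +
        P s * exp (r • L s) * P'ᵀ := fun r => by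
    rw [hP't, hPt s hs]
    refine velocity_eq hs ?_
    have hE : HasDerivWithinAt (fun s => exp (r • L s)) (fderiv ℝ exp (r • L s) (r • L'))
        (Set.Icc 0 1) s :=
      (hasFDerivAt_matrix_exp (r • L s)).comp_hasDerivWithinAt s (hLd.const_smul r)
    exact ((hPd.mul hE).mul hPd).congr (fun u hu => hgeo u hu r) (hgeo s hs r)
  have hconv := sqrt_metric_variation_le (P := P s) (L := L s) (P' := P') (L' := L')
    (γ := fun r => geodesic (c₁ s) (c₂ s) r)
    (J := fun r => velocity (fun s => geodesic (c₁ s) (c₂ s) r) s) (isUnit_matrix_exp _)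
    (hLe s hs).1 hL't (fun r => by rw [hPt s hs]; exact hgeo s hs r) hvel ht
  have hv₀ : velocity (fun s => geodesic (c₁ s) (c₂ s) 0) s = velocity c₁ s := by
    have hd := ((hs₁.differentiableOn (by simp)) s hs).hasDerivWithinAt
    rw [velocity_eq hs hd]
    exact velocity_eq hs (hd.congr (fun u hu => geodesic_zero (h₁.posDef u hu) (h₂.posDef u hu))
      (geodesic_zero (h₁.posDef s hs) (h₂.posDef s hs)))
  have hv₁ : velocity (fun s => geodesic (c₁ s) (c₂ s) 1) s = velocity c₂ s := by
    have hd := ((hs₂.differentiableOn (by simp)) s hs).hasDerivWithinAt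
    rw [velocity_eq hs hd]
    exact velocity_eq hs (hd.congr (fun u hu => geodesic_one (h₁.posDef u hu) (h₂.posDef u hu))
      (geodesic_one (h₁.posDef s hs) (h₂.posDef s hs)))
  simpa only [hv₀, hv₁, geodesic_zero (h₁.posDef s hs) (h₂.posDef s hs),
    geodesic_one (h₁.posDef s hs) (h₂.posDef s hs)] using hconv

theorem dist_geodesic_le {A B C : Matrix (Fin m) (Fin m) ℝ}
    {c₁ c₂ : ℝ → Matrix (Fin m) (Fin m) ℝ} (h₁ : IsSmoothCurve A C c₁)
    (h₂ : IsSmoothCurve B C c₂) {t : ℝ} (ht : t ∈ Set.Icc (0 : ℝ) 1) :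
    dist (geodesic A B t) C ≤ (1 - t) * length c₁ + t * length c₂ := by
  obtain ⟨hc, hle⟩ := geodesic_variation h₁ h₂ ht
  have hint : ∀ {X Y : Matrix (Fin m) (Fin m) ℝ} {c}, IsSmoothCurve X Y c →
      IntervalIntegrable (fun s => √(metric (c s) (velocity c s) (velocity c s)))
        MeasureTheory.volume 0 1 := fun hc => by
    refine ContinuousOn.intervalIntegrable ?_
    rw [Set.uIcc_of_le zero_le_one]
    exact continuousOn_speed hc
  refine (dist_le_length hc).trans ?_
  rw [length, length, length, ← intervalIntegral.integral_const_mul,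
    ← intervalIntegral.integral_const_mul,
    ← intervalIntegral.integral_add ((hint h₁).const_mul _) ((hint h₂).const_mul _)]
  exact intervalIntegral.integral_mono_on zero_le_one (hint hc)
    (((hint h₁).const_mul _).add ((hint h₂).const_mul _)) hle

theorem geodesicallyConvexSet_ball {C : Matrix (Fin m) (Fin m) ℝ} (hC : C.PosDef) (ρ : ℝ) :
    GeodesicallyConvexSet (ball C ρ) := by
  refine ⟨fun A hA => hA.1, fun A hA B hB t ht => ⟨posDef_geodesic hA.1 hB.1 t, ?_⟩⟩
  -- The infimum need not be attained, so curves of length below `ρ + ε` are used.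
  refine le_of_forall_pos_le_add fun ε hε => ?_
  obtain ⟨c₁, h₁, hl₁⟩ := exists_length_lt hA.1 hC (hA.2.trans_lt (lt_add_of_pos_right ρ hε))
  obtain ⟨c₂, h₂, hl₂⟩ := exists_length_lt hB.1 hC (hB.2.trans_lt (lt_add_of_pos_right ρ hε))
  refine (dist_geodesic_le h₁ h₂ ht).trans ?_
  nlinarith [mul_le_mul_of_nonneg_left hl₁.le (sub_nonneg.2 ht.2),
    mul_le_mul_of_nonneg_left hl₂.le ht.1]

end Curves

/-! ### Convexity of the objective along geodesics. -/

section Objective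

variable {m : ℕ}

theorem exists_geodesic_eq_diagonal {A B : Matrix (Fin m) (Fin m) ℝ} (hA : A.PosDef)
    (hB : B.PosDef) :
    ∃ (Q : Matrix (Fin m) (Fin m) ℝ) (l : Fin m → ℝ), IsUnit Q ∧
      ∀ t, geodesic A B t = Q * Matrix.diagonal (fun i => Real.exp (t * l i)) * Qᵀ := by
  obtain ⟨a, L, ha, hL, rfl, h⟩ := exists_geodesic_data hA hB
  obtain ⟨U, l, -, hU', hLU⟩ := exists_orthogonal_diagonalization hL
  refine ⟨exp ((1 / 2 : ℝ) • a) * U, l, (isUnit_matrix_exp _).mul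
    ((Matrix.isUnit_iff_isUnit_det U).2 (Matrix.isUnit_det_of_right_inverse hU')), fun t => ?_⟩
  have h1 : t • L = U * Matrix.diagonal (fun i => t * l i) * Uᵀ := by
    rw [hLU, ← Matrix.smul_mul, ← Matrix.mul_smul, ← Matrix.diagonal_smul]
    rfl
  have h2 : (exp ((1 / 2 : ℝ) • a))ᵀ = exp ((1 / 2 : ℝ) • a) := (isHermitian_smul ha _).exp
  rw [geodesic_exp ha hL h, h1, exp_orthogonal_diagonal hU', Matrix.transpose_mul, h2]
  simp only [Matrix.mul_assoc]

theorem geodesicallyConvexFun_objective {S : Matrix (Fin m) (Fin m) ℝ} (hS : S.PosSemidef) :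
    GeodesicallyConvexFun (objective S) := by
  intro A B hA hB t ht
  obtain ⟨Q, l, hQ, hgeo⟩ := exists_geodesic_eq_diagonal hA hB
  have hdet : Q.det ≠ 0 := ((Matrix.isUnit_iff_isUnit_det Q).1 hQ).ne_zero
  -- The coefficients of `exp (-(t * l i))` in the trace term: diagonal entries of a congruence of
  -- `Sᵀ`, hence nonnegative.
  set w : Fin m → ℝ := fun i => (Q⁻¹ * Sᵀ * (Q⁻¹)ᵀ) i i with hw
  have hwnn : ∀ i, 0 ≤ w i := fun i => by
    have h1 : (Q⁻¹ * Sᵀ * (Q⁻¹)ᴴ).PosSemidef := hS.transpose.mul_mul_conjTranspose_same _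
    rw [Matrix.conjTranspose_eq_transpose_of_trivial] at h1
    exact h1.diag_nonneg
  have hobj : ∀ r : ℝ, objective S (geodesic A B r) =
      ∑ i, w i * Real.exp (-(r * l i)) + (Real.log (Q.det * Q.det) + r * ∑ i, l i) := fun r => by
    have hdiag : (Matrix.diagonal fun i => Real.exp (r * l i))⁻¹ =
        Matrix.diagonal fun i => Real.exp (-(r * l i)) := by
      apply Matrix.inv_eq_right_inv
      rw [Matrix.diagonal_mul_diagonal]
      simp [← Real.exp_add]
    rw [objective, hgeo]
    congr 1
    · have h1 : (Sᵀ * ((Q⁻¹)ᵀ * ((Matrix.diagonal fun i => Real.exp (-(r * l i))) * Q⁻¹))).trace =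
          ((Q⁻¹ * Sᵀ * (Q⁻¹)ᵀ) * Matrix.diagonal fun i => Real.exp (-(r * l i))).trace := by
        rw [← Matrix.mul_assoc, ← Matrix.mul_assoc, Matrix.trace_mul_comm]
        simp only [Matrix.mul_assoc]
      rw [Matrix.mul_inv_rev, Matrix.mul_inv_rev, hdiag, ← Matrix.transpose_nonsing_inv, h1,
        Matrix.trace]
      simp only [Matrix.diag_apply, Matrix.mul_diagonal, hw]
    · rw [Matrix.det_mul, Matrix.det_mul, Matrix.det_transpose, Matrix.det_diagonal,
        ← Real.exp_sum, mul_right_comm, Real.log_mul (mul_ne_zero hdet hdet) (Real.exp_pos _).ne',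
        Real.log_exp, Finset.mul_sum]
  have h0 := hobj 0
  have h1 := hobj 1
  rw [geodesic_zero hA hB] at h0
  rw [geodesic_one hA hB] at h1
  rw [hobj, h0, h1]
  have hsum : ∑ i, w i * Real.exp (-(t * l i)) ≤
      (1 - t) * ∑ i, w i * Real.exp (-(0 * l i)) + t * ∑ i, w i * Real.exp (-(1 * l i)) := by
    rw [Finset.mul_sum, Finset.mul_sum, ← Finset.sum_add_distrib]
    refine Finset.sum_le_sum fun i _ => ?_
    have h2 := convexOn_exp.2 (Set.mem_univ (-(0 * l i))) (Set.mem_univ (-(1 * l i)))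
      (sub_nonneg.2 ht.2) ht.1 (by ring)
    have h3 : (1 - t) • -(0 * l i) + t • -(1 * l i) = -(t * l i) := by
      simp only [smul_eq_mul]; ring
    rw [h3] at h2
    have := mul_le_mul_of_nonneg_left h2 (hwnn i)
    simp only [smul_eq_mul] at this
    linarith
  linarith

end Objective

end FisherRao

theorem mainTheorem1 (n : ℕ) (Sigmahat S : Matrix (Fin n) (Fin n) ℝ) (ρ : ℝ)
    (hSigmahat : Sigmahat.PosDef) (hS : S.PosSemidef) (hρ : 0 ≤ ρ) :
    FisherRao.GeodesicallyConvexSet (FisherRao.ball Sigmahat ρ) ∧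
      FisherRao.GeodesicallyConvexFun (FisherRao.objective S) :=
  ⟨FisherRao.geodesicallyConvexSet_ball hSigmahat ρ,
    FisherRao.geodesicallyConvexFun_objective hS⟩
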